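/- Write $\mathrm{Tr}$ for the unnormalized trace on $M_n(\mathbb C)$ and $\|x\|_{S_1^n}=\mathrm{Tr}\big((x^*x)^{1/2}\big)$ for the trace norm of $x\in M_n(\mathbb C)$. For $C_1,\dots,C_d\in M_n(\mathbb C)$ put $$\|(C_i)_{i=1}^d\|_{S_1^n(\ell_2^{rc})}=\inf\Big\{\Big\|\Big(\sum_{i=1}^d X_i^*X_i\Big)^{1/2}\Big\|_{S_1^n}+\Big\|\Big(\sum_{i=1}^d Y_iY_i^*\Big)^{1/2}\Big\|_{S_1^n}\;:\;X_i,Y_i\in M_n(\mathbb C),\ C_i=X_i+Y_i\ (1\le i\le d)\Big\}.$$ For integers $k_1,\dots,k_d$ put $$\Big\|\sum_{i=1}^d C_i\otimes e^{2\pi i k_i(\cdot)}\Big\|_{L_1(\mathbb T;S_1^n)}=\int_0^1\Big\|\sum_{j=1}^d e^{2\pi i k_j t}\,C_j\Big\|_{S_1^n}\,dt .$$ For $W\subseteq\mathbb Z$ let $$Z_2(W)=\sup_{g\in\mathbb Z,\ g\ne 0}\#\{(x,y)\in W\times W: y-x=g\}\in\mathbb N\cup\{\infty\}.$$ **Theorem.**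 Let $W\subseteq\mathbb Z$. Suppose that $$\frac1{\sqrt2}\,\|(C_i)_{i=1}^d\|_{S_1^n(\ell_2^{rc})}\le\Big\|\sum_{i=1}^d C_i\otimes e^{2\pi i k_i(\cdot)}\Big\|_{L_1(\mathbb T;S_1^n)}$$ for all $d,n\in\mathbb N$, all $C_1,\dots,C_d\in M_n(\mathbb C)$ and all distinct $k_1,\dots,k_d\in W$. Then $Z_2(W)\le 6$. -/

import Mathlib

noncomputable section

open scoped Matrix MatrixOrder

/-- The trace norm `‖x‖_{S_1^n} = Tr ((x* x)^{1/2})` on `M_n(ℂ)`, with `Tr` the unnormalized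
trace. (The trace is a nonnegative real number, so its real part is the trace itself.) -/
def traceNorm {n : ℕ} (x : Matrix (Fin n) (Fin n) ℂ) : ℝ :=
  (CFC.sqrt (xᴴ * x)).trace.re

/-- The column norm `‖(∑ X_i* X_i)^{1/2}‖_{S_1^n}`. -/
def columnNorm {n d : ℕ} (X : Fin d → Matrix (Fin n) (Fin n) ℂ) : ℝ :=
  traceNorm (CFC.sqrt (∑ i, (X i)ᴴ * X i))

/-- The row norm `‖(∑ Y_i Y_i*)^{1/2}‖_{S_1^n}`. -/
def rowNorm {n d : ℕ} (Y : Fin d → Matrix (Fin n) (Fin n) ℂ) : ℝ :=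
  traceNorm (CFC.sqrt (∑ i, Y i * (Y i)ᴴ))

/-- The norm of `S_1^n(ℓ_2^{rc})`: the infimum of `columnNorm X + rowNorm Y` over all
decompositions `C_i = X_i + Y_i`. -/
def rcNorm {n d : ℕ} (C : Fin d → Matrix (Fin n) (Fin n) ℂ) : ℝ :=
  sInf {r : ℝ | ∃ X Y : Fin d → Matrix (Fin n) (Fin n) ℂ,
    (∀ i, C i = X i + Y i) ∧ r = columnNorm X + rowNorm Y}

/-- The function `∑ C_i ⊗ e^{2πi k_i ·}` on `𝕋 = ℝ/ℤ` with values in `M_n(ℂ)`, as a function of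
`t ∈ ℝ` of period one. -/
def matrixTrigPoly {n d : ℕ} (C : Fin d → Matrix (Fin n) (Fin n) ℂ) (k : Fin d → ℤ) (t : ℝ) :
    Matrix (Fin n) (Fin n) ℂ :=
  ∑ i, Complex.exp (2 * Real.pi * Complex.I * (k i : ℂ) * (t : ℂ)) • C i

/-- The norm of `L_1(𝕋; S_1^n)`, for (continuous) functions on `𝕋 = ℝ/ℤ` with its normalized
Haar measure, given as functions on `ℝ` of period one. -/
def l1TorusNorm {n : ℕ} (f : ℝ → Matrix (Fin n) (Fin n) ℂ) : ℝ :=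
  ∫ t in (0 : ℝ)..1, traceNorm (f t)

/-- The `Z_2` constant of a subset `V` of an (additively written) discrete group: the supremum over
`g ≠ 0` of the number of pairs `(x, y) ∈ V × V` with `-x + y = g`, an element of `ℕ ∪ {∞}`. -/
def zTwo {Γ : Type*} [AddGroup Γ] (V : Set Γ) : ℕ∞ :=
  ⨆ g : Γ, ⨆ _ : g ≠ 0, {p : Γ × Γ | p.1 ∈ V ∧ p.2 ∈ V ∧ -p.1 + p.2 = g}.encard

end

/-! Suppose some g ≠ 0 is the difference of seven pairs from W. The hypothesis is tested on the
matrices c_i a_j P_m at the frequencies x_j + i g, where the a_j are creation operators on 2m+1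
fermionic modes and P_m projects onto m particles. At this middle level the row and column square
sums are both (m+1) ∑ c_i² times a projection, so the family, rescaled, is its own dual witness for
`rcNorm` (`re_sum_trace_le_rcNorm`). On the other side the polynomial factors as the scalar ∑ c_i
e^{2πi i g t} times a unimodular combination of the a_j P_m, and whatever the phases this
combination is √(2m+1) times a partial isometry (`sq_conjTranspose_mul_self`), so its trace norm is
constant in t.

What remains is scalar: if W contains 2m+1 disjoint g-progressions of length s, then (2m+1) ∑ c_i² ≤
2(m+1) ‖∑ c_i z^i‖₁². This fails in three cases: one progression of length 5 with (1+z+z²)², where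
it reads 19 ≤ 18; three of length 3 with (1+z)², where it reads 18 ≤ 16; five pairs with 1+z, where
it reads 10 ≤ 96/π². Seven pairs always supply one of these configurations (`exists_progressions`).
-/

section Khintchine

open scoped Matrix MatrixOrder

/-! ### Trace duality for row and column norms -/

section TraceNorm

open scoped ComplexOrder

/-- The diagonal of `∑ X_i* X_i` consists of the squared `ℓ²` norms of the stacked columns. -/
theorem sum_conjTranspose_mul_self_apply_re {ι m : Type*} [Fintype ι] [Fintype m]
    (X : ι → Matrix m m ℂ) (k : m) :
    ((∑ i, (X i)ᴴ * X i) k k).re = ∑ p : ι × m, ‖X p.1 p.2 k‖ ^ 2 := by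
  rw [Matrix.sum_apply, Complex.re_sum, Fintype.sum_prod_type]
  refine Finset.sum_congr rfl fun i _ => ?_
  rw [Matrix.mul_apply, Complex.re_sum]
  refine Finset.sum_congr rfl fun r _ => ?_
  rw [Matrix.conjTranspose_apply, Complex.star_def, ← Complex.normSq_eq_conj_mul_self,
    Complex.ofReal_re, Complex.normSq_eq_norm_sq]

/-- Duality between column square functions, for a diagonalized square function. -/
theorem re_sum_trace_le_of_diagonal {ι m : Type*} [Fintype ι] [Fintype m] [DecidableEq m]
    (X B : ι → Matrix m m ℂ) (μ : m → ℝ) (hμ : ∀ k, 0 ≤ μ k)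
    (hX : ∀ k, ((∑ i, (X i)ᴴ * X i) k k).re = μ k ^ 2)
    (hB : ∀ k, ((∑ i, (B i)ᴴ * B i) k k).re ≤ 1) :
    (∑ i, ((B i)ᴴ * X i).trace).re ≤ ∑ k, μ k := by
  have h1 : (∑ i, ((B i)ᴴ * X i).trace).re
      = ∑ k, ∑ p : ι × m, (star (B p.1 p.2 k) * X p.1 p.2 k).re := by
    simp only [Matrix.trace, Matrix.diag, Matrix.mul_apply, Matrix.conjTranspose_apply,
      Complex.re_sum, Fintype.sum_prod_type]
    rw [Finset.sum_comm]
  rw [h1]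
  refine Finset.sum_le_sum fun k _ => ?_
  calc ∑ p : ι × m, (star (B p.1 p.2 k) * X p.1 p.2 k).re
      ≤ ∑ p : ι × m, ‖B p.1 p.2 k‖ * ‖X p.1 p.2 k‖ := by
        refine Finset.sum_le_sum fun p _ => (Complex.re_le_norm _).trans ?_
        rw [norm_mul, norm_star]
    _ ≤ √(∑ p : ι × m, ‖B p.1 p.2 k‖ ^ 2) * √(∑ p : ι × m, ‖X p.1 p.2 k‖ ^ 2) :=
        Real.sum_mul_le_sqrt_mul_sqrt _ _ _
    _ ≤ 1 * μ k := by
        rw [← sum_conjTranspose_mul_self_apply_re, ← sum_conjTranspose_mul_self_apply_re, hX,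
          Real.sqrt_sq (hμ k)]
        exact mul_le_mul_of_nonneg_right (Real.sqrt_le_one.2 (hB k)) (hμ k)
    _ = μ k := one_mul _

theorem traceNorm_of_nonneg {n : ℕ} {S : Matrix (Fin n) (Fin n) ℂ} (hS : 0 ≤ S) :
    traceNorm S = S.trace.re := by
  have h : Sᴴ = S := (Matrix.nonneg_iff_posSemidef.1 hS).1
  rw [traceNorm, h, CFC.sqrt_unique rfl hS]

/-- In an eigenbasis of the square root S of the column square sum, the k-th stacked column of X has
ℓ² norm equal to the k-th eigenvalue and that of B has norm at most 1. Cauchy–Schwarz column by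
column then gives the trace of S. -/
theorem re_sum_trace_le_columnNorm {n d : ℕ} (X B : Fin d → Matrix (Fin n) (Fin n) ℂ)
    (hB : ∑ i, (B i)ᴴ * B i ≤ 1) :
    (∑ i, ((B i)ᴴ * X i).trace).re ≤ columnNorm X := by
  have hpos : 0 ≤ ∑ i, (X i)ᴴ * X i := Finset.sum_nonneg fun i _ =>
    Matrix.nonneg_iff_posSemidef.2 (Matrix.posSemidef_conjTranspose_mul_self _)
  have hS := CFC.sqrt_nonneg (∑ i, (X i)ᴴ * X i)
  have hSS := CFC.sqrt_mul_sqrt_self (∑ i, (X i)ᴴ * X i) hpos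
  rw [columnNorm, traceNorm_of_nonneg hS]
  generalize CFC.sqrt (∑ i, (X i)ᴴ * X i) = S at hS hSS
  have hP := Matrix.nonneg_iff_posSemidef.1 hS
  set U : Matrix (Fin n) (Fin n) ℂ := (hP.1.eigenvectorUnitary : Matrix (Fin n) (Fin n) ℂ)
  set D : Matrix (Fin n) (Fin n) ℂ := Matrix.diagonal (RCLike.ofReal ∘ hP.1.eigenvalues)
  have hUU : Uᴴ * U = 1 := Unitary.star_mul_self_of_mem hP.1.eigenvectorUnitary.2
  have hUU' : U * Uᴴ = 1 := Unitary.mul_star_self_of_mem hP.1.eigenvectorUnitary.2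
  have hspec : S = U * D * Uᴴ := by
    have := hP.1.spectral_theorem
    rwa [Unitary.conjStarAlgAut_apply] at this
  have htr : S.trace.re = ∑ k, hP.1.eigenvalues k := by
    rw [hP.1.trace_eq_sum_eigenvalues, Complex.re_sum]; simp
  have hconj : ∀ Y : Fin d → Matrix (Fin n) (Fin n) ℂ,
      ∑ i, (Y i * U)ᴴ * (Y i * U) = Uᴴ * (∑ i, (Y i)ᴴ * Y i) * U := fun Y => by
    rw [Matrix.mul_sum, Matrix.sum_mul]
    exact Finset.sum_congr rfl fun i _ => by simp only [Matrix.conjTranspose_mul, mul_assoc]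
  have hl : ∑ i, ((B i)ᴴ * X i).trace = ∑ i, ((B i * U)ᴴ * (X i * U)).trace :=
    Finset.sum_congr rfl fun i _ => by
      rw [Matrix.conjTranspose_mul, mul_assoc, Matrix.trace_mul_comm Uᴴ, mul_assoc, mul_assoc,
        hUU', mul_one]
  rw [htr, hl]
  refine re_sum_trace_le_of_diagonal _ _ _ hP.eigenvalues_nonneg (fun k => ?_) fun k => ?_
  · have : Uᴴ * (S * S) * U = D * D := by
      calc Uᴴ * (S * S) * U = Uᴴ * (U * D * Uᴴ * (U * D * Uᴴ)) * U := by rw [← hspec]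
        _ = (Uᴴ * U) * D * (Uᴴ * U) * D * (Uᴴ * U) := by simp only [mul_assoc]
        _ = _ := by simp [hUU]
    rw [hconj, ← hSS, this, Matrix.diagonal_mul_diagonal, Matrix.diagonal_apply_eq]
    simp [sq]
  · have h := ((Matrix.le_iff.1 hB).conjTranspose_mul_mul_same U).diag_nonneg (i := k)
    rw [mul_sub, sub_mul, mul_one, hUU, ← hconj] at h
    have h' := (Complex.le_def.1 h).1
    simp only [Matrix.sub_apply, Matrix.one_apply_eq, Complex.zero_re, Complex.sub_re,
      Complex.one_re] at h'
    linarith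

theorem re_sum_trace_le_rowNorm {n d : ℕ} (Y B : Fin d → Matrix (Fin n) (Fin n) ℂ)
    (hB : ∑ i, B i * (B i)ᴴ ≤ 1) :
    (∑ i, ((B i)ᴴ * Y i).trace).re ≤ rowNorm Y := by
  have h := re_sum_trace_le_columnNorm (fun i => (Y i)ᴴ) (fun i => (B i)ᴴ) (by simpa using hB)
  have hr : columnNorm (fun i => (Y i)ᴴ) = rowNorm Y := by
    simp [columnNorm, rowNorm]
  rw [hr] at h
  refine le_of_eq_of_le ?_ h
  rw [Complex.re_sum, Complex.re_sum]
  refine Finset.sum_congr rfl fun i _ => ?_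
  rw [← Complex.conj_re, ← Complex.star_def, ← Matrix.trace_conjTranspose,
    Matrix.conjTranspose_mul, Matrix.conjTranspose_conjTranspose, Matrix.trace_mul_comm]

/-- A family that is a contraction both as a row and as a column tests the norm of
`S_1^n(ℓ_2^{rc})` from below. -/
theorem re_sum_trace_le_rcNorm {n d : ℕ} (C B : Fin d → Matrix (Fin n) (Fin n) ℂ)
    (hc : ∑ i, (B i)ᴴ * B i ≤ 1) (hr : ∑ i, B i * (B i)ᴴ ≤ 1) :
    (∑ i, ((B i)ᴴ * C i).trace).re ≤ rcNorm C := by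
  refine le_csInf ⟨_, C, 0, by simp, rfl⟩ ?_
  rintro _ ⟨X, Y, h, rfl⟩
  have : ∑ i, ((B i)ᴴ * C i).trace
      = ∑ i, ((B i)ᴴ * X i).trace + ∑ i, ((B i)ᴴ * Y i).trace := by
    simp only [h, mul_add, Matrix.trace_add, Finset.sum_add_distrib]
  rw [this, Complex.add_re]
  exact add_le_add (re_sum_trace_le_columnNorm X B hc) (re_sum_trace_le_rowNorm Y B hr)

/-- The trace norm of a scalar multiple of a matrix that is `c` times a partial isometry. -/
theorem traceNorm_smul_of_sq_eq {n : ℕ} {u : Matrix (Fin n) (Fin n) ℂ} {c : ℝ} (hc : 0 < c)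
    (hu : (uᴴ * u) * (uᴴ * u) = ((c ^ 2 : ℝ) : ℂ) • (uᴴ * u)) (z : ℂ) :
    traceNorm (z • u) = ‖z‖ * ((uᴴ * u).trace.re / c) := by
  -- Since (u*u)² = c² u*u, the modulus of z u is (|z|/c) u*u.
  have hpos : 0 ≤ ((‖z‖ / c : ℝ) : ℂ) • (uᴴ * u) :=
    Matrix.nonneg_iff_posSemidef.2
      ((Matrix.posSemidef_conjTranspose_mul_self u).smul (by positivity))
  have hsq : ((‖z‖ / c : ℝ) : ℂ) • (uᴴ * u) * ((‖z‖ / c : ℝ) : ℂ) • (uᴴ * u)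
      = (z • u)ᴴ * (z • u) := by
    rw [smul_mul_smul_comm, hu, Matrix.conjTranspose_smul, smul_mul_smul_comm, smul_smul]
    congr 1
    rw [Complex.star_def, ← Complex.normSq_eq_conj_mul_self, Complex.normSq_eq_norm_sq]
    norm_cast
    field_simp
  rw [traceNorm, CFC.sqrt_unique hsq hpos, Matrix.trace_smul, smul_eq_mul, Complex.re_ofReal_mul]
  ring

end TraceNorm

/-! ### Fermionic creation operators -/

/-- `a` is a family of `d` fermionic creation operators (they satisfy the canonical
anticommutation relations), and `P k` is the projection onto the `k`-particle space. -/
structure IsFockSystem {ι : Type*} [Fintype ι] [DecidableEq ι] {d : ℕ}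
    (a : Fin d → Matrix ι ι ℂ) (P : ℕ → Matrix ι ι ℂ) : Prop where
  anticomm : ∀ i j, a i * a j + a j * a i = 0
  car : ∀ i j, a i * (a j)ᴴ + (a j)ᴴ * a i = if i = j then 1 else 0
  isHermitian : ∀ k, (P k)ᴴ = P k
  idem : ∀ k, P k * P k = P k
  raise : ∀ i k, a i * P k = P (k + 1) * a i
  vacuum : ∀ i, P 0 * a i = 0
  number : ∀ k, (∑ i, a i * (a i)ᴴ) * P k = (k : ℂ) • P k
  trace_eq : ∀ k, (P k).trace = (d.choose k : ℂ)

theorem IsFockSystem.zero :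
    IsFockSystem (d := 0) (fun _ => (0 : Matrix (Fin 1) (Fin 1) ℂ))
      (fun k => if k = 0 then 1 else 0) where
  anticomm i := i.elim0
  car i := i.elim0
  isHermitian k := by split_ifs <;> simp
  idem k := by split_ifs <;> simp
  raise i := i.elim0
  vacuum i := i.elim0
  number k := by
    rcases k with _ | k <;> simp
  trace_eq k := by
    rcases k with _ | k <;> simp

theorem trace_fromBlocks_eq {m n : Type*} [Fintype m] [Fintype n] (A : Matrix m m ℂ)
    (B : Matrix m n ℂ) (C : Matrix n m ℂ) (D : Matrix n n ℂ) :
    (Matrix.fromBlocks A B C D).trace = A.trace + D.trace := by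
  simp [Matrix.trace, Fintype.sum_sum_type]

/-- Adjoining one more fermionic mode. -/
theorem IsFockSystem.succ {ι : Type*} [Fintype ι] [DecidableEq ι] {d : ℕ}
    {a : Fin d → Matrix ι ι ℂ} {P : ℕ → Matrix ι ι ℂ} (h : IsFockSystem a P) :
    IsFockSystem (d := d + 1)
      -- The first block is the space where the new mode is empty, the second where it is occupied.
      -- The sign in -a i makes the old modes anticommute with the new one (Jordan–Wigner).
      (Fin.cons (Matrix.fromBlocks 0 0 1 0) fun i => Matrix.fromBlocks (a i) 0 0 (-a i))
      (fun k => Matrix.fromBlocks (P k) 0 0 (Nat.casesOn k 0 P)) where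
  anticomm i j := by
    refine Fin.cases ?_ (fun i => ?_) i <;> refine Fin.cases ?_ (fun j => ?_) j <;>
      simp [Matrix.fromBlocks_multiply, Matrix.fromBlocks_add, h.anticomm]
  car i j := by
    refine Fin.cases ?_ (fun i => ?_) i <;> refine Fin.cases ?_ (fun j => ?_) j <;>
      simp [Matrix.fromBlocks_multiply, Matrix.fromBlocks_add, Matrix.fromBlocks_conjTranspose,
        h.car, Fin.succ_ne_zero, (Fin.succ_ne_zero _).symm]
    split_ifs <;> simp
  isHermitian k := by
    rcases k with _ | k <;> simp [Matrix.fromBlocks_conjTranspose, h.isHermitian]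
  idem k := by
    rcases k with _ | k <;> simp [Matrix.fromBlocks_multiply, h.idem]
  raise i k := by
    -- At k = 0 the occupied block carries "P (-1)" = 0, and there `vacuum` plays the part of
    -- `raise` at level -1.
    refine Fin.cases ?_ (fun i => ?_) i <;> rcases k with _ | k <;>
      simp [Matrix.fromBlocks_multiply, h.raise, h.vacuum]
  vacuum i := by
    refine Fin.cases ?_ (fun i => ?_) i <;> simp [Matrix.fromBlocks_multiply, h.vacuum]
  number k := by
    have hs : ∑ i : Fin d, Matrix.fromBlocks (a i * (a i)ᴴ) 0 0 (a i * (a i)ᴴ)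
        = Matrix.fromBlocks (∑ i, a i * (a i)ᴴ) 0 0 (∑ i, a i * (a i)ᴴ) := by
      ext i j
      rcases i with i | i <;> rcases j with j | j <;> simp [Matrix.sum_apply]
    rw [Fin.sum_univ_succ]
    rcases k with _ | k <;>
      simp [Matrix.fromBlocks_multiply, Matrix.fromBlocks_conjTranspose, hs,
        Matrix.fromBlocks_add, h.number, Matrix.fromBlocks_smul, add_mul, add_smul, add_comm]
  trace_eq k := by
    rw [trace_fromBlocks_eq]
    rcases k with _ | k <;> simp [h.trace_eq, Nat.choose_succ_succ, add_comm]

theorem IsFockSystem.submatrix {ι κ : Type*} [Fintype ι] [DecidableEq ι] [Fintype κ]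
    [DecidableEq κ] {d : ℕ} {a : Fin d → Matrix ι ι ℂ} {P : ℕ → Matrix ι ι ℂ}
    (h : IsFockSystem a P) (e : κ ≃ ι) :
    IsFockSystem (fun i => (a i).submatrix e e) (fun k => (P k).submatrix e e) := by
  have hm : ∀ A B : Matrix ι ι ℂ, A.submatrix e e * B.submatrix e e = (A * B).submatrix e e :=
    fun A B => Matrix.submatrix_mul_equiv _ _ _ _ _
  have hadd : ∀ A B : Matrix ι ι ℂ, A.submatrix e e + B.submatrix e e = (A + B).submatrix e e :=
    fun A B => rfl
  constructor
  · intro i j; simp only [hm, hadd, h.anticomm]; rfl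
  · intro i j
    simp only [Matrix.conjTranspose_submatrix, hm, hadd, h.car]
    split_ifs <;> simp
  · intro k; simp only [Matrix.conjTranspose_submatrix, h.isHermitian]
  · intro k; simp only [hm, h.idem]
  · intro i k; simp only [hm, h.raise]
  · intro i; simp only [hm, h.vacuum]; rfl
  · intro k
    have hs : ∑ i, ((a i) * (a i)ᴴ).submatrix e e = (∑ i, (a i) * (a i)ᴴ).submatrix e e := by
      ext; simp [Matrix.sum_apply]
    simp only [Matrix.conjTranspose_submatrix, hm, hs, h.number]; rfl
  · intro k
    rw [← h.trace_eq]
    exact Fintype.sum_equiv e _ _ fun _ => rfl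

theorem exists_isFockSystem (d : ℕ) : ∃ (n : ℕ) (a : Fin d → Matrix (Fin n) (Fin n) ℂ)
    (P : ℕ → Matrix (Fin n) (Fin n) ℂ), IsFockSystem a P := by
  induction d with
  | zero => exact ⟨1, _, _, .zero⟩
  | succ d ih =>
    obtain ⟨n, a, P, h⟩ := ih
    exact ⟨n + n, _, _, h.succ.submatrix finSumFinEquiv.symm⟩

namespace IsFockSystem

variable {ι : Type*} [Fintype ι] [DecidableEq ι] {d : ℕ} {a : Fin d → Matrix ι ι ℂ}
  {P : ℕ → Matrix ι ι ℂ}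

theorem lower (h : IsFockSystem a P) (i : Fin d) (k : ℕ) :
    (a i)ᴴ * P (k + 1) = P k * (a i)ᴴ := by
  have := congrArg Matrix.conjTranspose (h.raise i k)
  simp only [Matrix.conjTranspose_mul, h.isHermitian] at this
  exact this.symm

theorem number_compl (h : IsFockSystem a P) (k : ℕ) :
    (∑ i, (a i)ᴴ * a i) * P k = ((d : ℂ) - k) • P k := by
  have hs : ∑ i, a i * (a i)ᴴ + ∑ i, (a i)ᴴ * a i = (d : ℂ) • 1 := by
    rw [← Finset.sum_add_distrib]
    simp [h.car, Nat.cast_smul_eq_nsmul]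
  rw [eq_sub_of_add_eq' hs, sub_mul, h.number, sub_smul, smul_mul_assoc, one_mul]

theorem mul_self (h : IsFockSystem a P) (i : Fin d) : a i * a i = 0 := by
  have := h.anticomm i i
  rw [← two_smul ℂ] at this
  exact (smul_eq_zero.1 this).resolve_left two_ne_zero

/-- The column square function of the restriction of the creation operators to `k` particles. -/
theorem sum_conjTranspose_mul (h : IsFockSystem a P) (k : ℕ) :
    ∑ i, (a i * P k)ᴴ * (a i * P k) = ((d : ℂ) - k) • P k := by
  have : ∀ i, (a i * P k)ᴴ * (a i * P k) = P k * ((a i)ᴴ * a i * P k) := fun i => by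
    rw [Matrix.conjTranspose_mul, h.isHermitian]; simp only [mul_assoc]
  simp only [this]
  rw [← Matrix.mul_sum, ← Matrix.sum_mul, h.number_compl, mul_smul_comm, h.idem]

/-- The row square function of the restriction of the creation operators to `k` particles. -/
theorem sum_mul_conjTranspose (h : IsFockSystem a P) (k : ℕ) :
    ∑ i, (a i * P k) * (a i * P k)ᴴ = ((k + 1 : ℕ) : ℂ) • P (k + 1) := by
  have : ∀ i, (a i * P k) * (a i * P k)ᴴ = a i * (a i)ᴴ * P (k + 1) := fun i => by
    rw [Matrix.conjTranspose_mul, h.isHermitian, mul_assoc, ← mul_assoc (P k), h.idem, mul_assoc,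
      h.lower]
  simp only [this]
  rw [← Matrix.sum_mul, h.number]

/-- The operator (a i)ᴴ * a j changes the occupation of mode i, so it has no diagonal part with
respect to that mode. Algebraically: insert the projection (a i)ᴴ * a i, which commutes with P k,
move it around cyclically, and use that (a i)ᴴ squares to zero. -/
theorem trace_conjTranspose_mul_of_ne (h : IsFockSystem a P) {i j : Fin d} (hij : i ≠ j) (k : ℕ) :
    ((a i * P k)ᴴ * (a j * P k)).trace = 0 := by
  have h1 : (a i)ᴴ * a j = -(a j * (a i)ᴴ) := by
    have := h.car j i
    rw [if_neg hij.symm] at this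
    exact eq_neg_of_add_eq_zero_right this
  have h0 : (a i)ᴴ * (a i)ᴴ = 0 := by
    rw [← Matrix.conjTranspose_mul, h.mul_self, Matrix.conjTranspose_zero]
  have hPa : P k * (a i)ᴴ * a i = (a i)ᴴ * a i * P k := by
    rw [← h.lower, mul_assoc, ← h.raise, mul_assoc]
  have h2 : (a i)ᴴ * a j = (a i)ᴴ * a i * ((a i)ᴴ * a j) := by
    calc (a i)ᴴ * a j = (a i)ᴴ * (a i * (a i)ᴴ + (a i)ᴴ * a i) * a j := by
          rw [h.car i i, if_pos rfl, mul_one]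
      _ = (a i)ᴴ * a i * ((a i)ᴴ * a j) + (a i)ᴴ * (a i)ᴴ * (a i * a j) := by
          simp only [mul_add, add_mul, mul_assoc]
      _ = _ := by rw [h0, zero_mul, add_zero]
  calc ((a i * P k)ᴴ * (a j * P k)).trace
      = (P k * ((a i)ᴴ * a j * P k)).trace := by
        rw [Matrix.conjTranspose_mul, h.isHermitian]; simp only [mul_assoc]
    _ = (P k * ((a i)ᴴ * a j)).trace := by
        rw [Matrix.trace_mul_comm, mul_assoc, h.idem, Matrix.trace_mul_comm]
    _ = (P k * ((a i)ᴴ * a i) * ((a i)ᴴ * a j)).trace := by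
        rw [mul_assoc, ← h2]
    _ = ((a i)ᴴ * a i * P k * ((a i)ᴴ * a j)).trace := by rw [← mul_assoc (P k), hPa]
    _ = (P k * ((a i)ᴴ * a j * (a i)ᴴ * a i)).trace := by
        rw [mul_assoc, Matrix.trace_mul_comm]; simp only [mul_assoc]
    _ = 0 := by rw [h1, neg_mul, mul_assoc (a j), h0]; simp

/-- For every vector `v`, the operator `∑ v i • a i` restricted to `k` particles is a multiple of
a partial isometry. -/
theorem sq_conjTranspose_mul_self (h : IsFockSystem a P) (v : Fin d → ℂ) (k : ℕ) :
    ((∑ i, v i • (a i * P k))ᴴ * ∑ i, v i • (a i * P k)) *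
        ((∑ i, v i • (a i * P k))ᴴ * ∑ i, v i • (a i * P k)) =
      ((∑ i, ‖v i‖ ^ 2 : ℝ) : ℂ) •
        ((∑ i, v i • (a i * P k))ᴴ * ∑ i, v i • (a i * P k)) := by
  set A : Matrix ι ι ℂ := ∑ i, v i • a i with hA
  have hAP : ∑ i, v i • (a i * P k) = A * P k := by
    rw [hA, Matrix.sum_mul]; simp only [smul_mul_assoc]
  have hraise : A * P k = P (k + 1) * A := by
    rw [hA, Matrix.sum_mul, Matrix.mul_sum]; simp only [smul_mul_assoc, mul_smul_comm, h.raise]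
  have hlower : Aᴴ * P (k + 1) = P k * Aᴴ := by
    have := congrArg Matrix.conjTranspose hraise
    simp only [Matrix.conjTranspose_mul, h.isHermitian] at this
    exact this.symm
  -- A again satisfies the relations of a single mode, up to the factor ∑ |v i|²; the identity for
  -- A*A follows, and A*A commutes with P k.
  have hAA : A * A = 0 := by
    have h2 : A * A + A * A = 0 := by
      have e1 : A * A = ∑ i, ∑ j, (v i * v j) • (a i * a j) := by
        rw [hA, Matrix.sum_mul]; simp only [Matrix.mul_sum, smul_mul_smul_comm]
      have e2 : A * A = ∑ i, ∑ j, (v i * v j) • (a j * a i) := by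
        rw [e1, Finset.sum_comm]; simp only [mul_comm]
      nth_rewrite 1 [e1]
      rw [e2]
      simp only [← Finset.sum_add_distrib, ← smul_add, h.anticomm, smul_zero,
        Finset.sum_const_zero]
    rw [← two_smul ℂ] at h2
    exact (smul_eq_zero.1 h2).resolve_left two_ne_zero
  have hcar : A * Aᴴ + Aᴴ * A = ((∑ i, ‖v i‖ ^ 2 : ℝ) : ℂ) • 1 := by
    have e1 : A * Aᴴ = ∑ i, ∑ j, (v i * star (v j)) • (a i * (a j)ᴴ) := by
      rw [hA, Matrix.conjTranspose_sum, Matrix.sum_mul]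
      simp only [Matrix.conjTranspose_smul, Matrix.mul_sum, smul_mul_smul_comm]
    have e2 : Aᴴ * A = ∑ i, ∑ j, (v i * star (v j)) • ((a j)ᴴ * a i) := by
      rw [Finset.sum_comm, hA, Matrix.conjTranspose_sum, Matrix.sum_mul]
      simp only [Matrix.conjTranspose_smul, Matrix.mul_sum, smul_mul_smul_comm, mul_comm]
    rw [e1, e2]
    simp only [← Finset.sum_add_distrib, ← smul_add, h.car, smul_ite, smul_zero,
      Finset.sum_ite_eq, Finset.mem_univ, if_true, ← Finset.sum_smul]
    congr 1
    push_cast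
    refine Finset.sum_congr rfl fun i _ => ?_
    rw [Complex.star_def, Complex.mul_conj, Complex.normSq_eq_norm_sq, Complex.ofReal_pow]
  have hcomm : Aᴴ * A * P k = P k * (Aᴴ * A) := by
    rw [mul_assoc, hraise, ← mul_assoc, hlower, mul_assoc]
  have h1 : (A * P k)ᴴ * (A * P k) = Aᴴ * A * P k := by
    calc (A * P k)ᴴ * (A * P k) = P k * (Aᴴ * A * P k) := by
          rw [Matrix.conjTranspose_mul, h.isHermitian]; simp only [mul_assoc]
      _ = _ := by rw [hcomm, ← mul_assoc, h.idem]
  have h2 : Aᴴ * A * (Aᴴ * A) = ((∑ i, ‖v i‖ ^ 2 : ℝ) : ℂ) • (Aᴴ * A) := by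
    calc Aᴴ * A * (Aᴴ * A) = Aᴴ * (A * Aᴴ + Aᴴ * A) * A - Aᴴ * Aᴴ * (A * A) := by
          noncomm_ring
      _ = _ := by rw [hcar, hAA, mul_zero, sub_zero, mul_smul_comm, mul_one, smul_mul_assoc]
  rw [hAP, h1]
  calc Aᴴ * A * P k * (Aᴴ * A * P k) = Aᴴ * A * (P k * (Aᴴ * A)) * P k := by
        simp only [mul_assoc]
    _ = Aᴴ * A * (Aᴴ * A) * (P k * P k) := by rw [← hcomm]; simp only [mul_assoc]
    _ = _ := by rw [h2, h.idem, smul_mul_assoc]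

end IsFockSystem

/-! ### Characters of the circle and the test family -/

/-- The character `t ↦ e^{2πi k t}` of the circle `ℝ/ℤ`. -/
noncomputable def circleChar (k : ℤ) (t : ℝ) : ℂ :=
  Complex.exp (2 * Real.pi * Complex.I * (k : ℂ) * (t : ℂ))

theorem circleChar_eq (k : ℤ) (t : ℝ) :
    circleChar k t = Complex.exp ((2 * Real.pi * k * t : ℝ) * Complex.I) := by
  rw [circleChar]; congr 1; push_cast; ring

theorem norm_circleChar (k : ℤ) (t : ℝ) : ‖circleChar k t‖ = 1 := by
  rw [circleChar_eq, Complex.norm_exp_ofReal_mul_I]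

theorem circleChar_add (k l : ℤ) (t : ℝ) :
    circleChar (k + l) t = circleChar k t * circleChar l t := by
  simp only [circleChar, ← Complex.exp_add]; congr 1; push_cast; ring

theorem circleChar_natCast_mul (i : ℕ) (g : ℤ) (t : ℝ) :
    circleChar (i * g) t = circleChar 1 (g * t) ^ i := by
  simp only [circleChar, ← Complex.exp_nat_mul]; congr 1; push_cast; ring

namespace IsFockSystem

variable {n d : ℕ} {a : Fin d → Matrix (Fin n) (Fin n) ℂ} {P : ℕ → Matrix (Fin n) (Fin n) ℂ}

theorem trace_conjTranspose_sum_mul_self (h : IsFockSystem a P) (v : Fin d → ℂ)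
    (hv : ∀ i, ‖v i‖ = 1) (k : ℕ) :
    ((∑ i, v i • (a i * P k))ᴴ * ∑ i, v i • (a i * P k)).trace
      = ((d : ℂ) - k) * (d.choose k : ℂ) := by
  have h1 : ∀ i j, ((v i • (a i * P k))ᴴ * (v j • (a j * P k))).trace
      = if i = j then ((a i * P k)ᴴ * (a i * P k)).trace else 0 := fun i j => by
    rw [Matrix.conjTranspose_smul, smul_mul_smul_comm, Matrix.trace_smul]
    split_ifs with hij
    · subst hij
      rw [Complex.star_def, ← Complex.normSq_eq_conj_mul_self, Complex.normSq_eq_norm_sq, hv]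
      simp
    · rw [h.trace_conjTranspose_mul_of_ne hij, smul_zero]
  rw [Matrix.conjTranspose_sum, Matrix.sum_mul, Matrix.trace_sum]
  simp only [Matrix.mul_sum, Matrix.trace_sum, h1, Finset.sum_ite_eq, Finset.mem_univ, if_true]
  rw [← Matrix.trace_sum, h.sum_conjTranspose_mul, Matrix.trace_smul, h.trace_eq, smul_eq_mul]

open scoped ComplexOrder in
theorem projection_le_one (h : IsFockSystem a P) (k : ℕ) : P k ≤ 1 := by
  have : 1 - P k = (1 - P k)ᴴ * (1 - P k) := by
    rw [Matrix.conjTranspose_sub, h.isHermitian, Matrix.conjTranspose_one]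
    simp only [sub_mul, mul_sub, one_mul, mul_one, h.idem, sub_self, sub_zero]
  rw [Matrix.le_iff, this]
  exact Matrix.posSemidef_conjTranspose_mul_self _

end IsFockSystem

/-- Testing the noncommutative Khintchine inequality on fermionic creation operators placed along
`2m+1` disjoint progressions of step `g`. -/
theorem khintchine_progressions {W : Set ℤ}
    (hW : ∀ (n d : ℕ) (C : Fin d → Matrix (Fin n) (Fin n) ℂ) (k : Fin d → ℤ),
      Function.Injective k → (∀ i, k i ∈ W) →
        1 / √2 * rcNorm C ≤ l1TorusNorm (matrixTrigPoly C k))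
    (m s : ℕ) (c : Fin s → ℝ) (g : ℤ) (x : Fin (2 * m + 1) → ℤ)
    (hx : Function.Injective fun p : Fin (2 * m + 1) × Fin s => x p.1 + (p.2 : ℕ) * g)
    (hxW : ∀ j (i : Fin s), x j + (i : ℕ) * g ∈ W) :
    √(∑ i, c i ^ 2) * √(2 * m + 1) ≤ √2 * √(m + 1) *
      ∫ t in (0 : ℝ)..1, ‖∑ i : Fin s, (c i : ℂ) * circleChar 1 (g * t) ^ (i : ℕ)‖ := by
  obtain ⟨n, a, P, h⟩ := exists_isFockSystem (2 * m + 1)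
  set τ : ℝ := ((2 * m + 1).choose m : ℝ)
  have hτ : 0 < τ := by
    have : 0 < (2 * m + 1).choose m := Nat.choose_pos (by omega)
    exact Nat.cast_pos.2 this
  let e : Fin (2 * m + 1) × Fin s ≃ Fin ((2 * m + 1) * s) := finProdFinEquiv
  let C : Fin ((2 * m + 1) * s) → Matrix (Fin n) (Fin n) ℂ :=
    fun q => (c (e.symm q).2 : ℂ) • (a (e.symm q).1 * P m)
  let k : Fin ((2 * m + 1) * s) → ℤ := fun q => x (e.symm q).1 + ((e.symm q).2 : ℕ) * g
  have hsum : ∀ {M : Type} [AddCommMonoid M] (F : Fin (2 * m + 1) → Fin s → M),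
      ∑ q, F (e.symm q).1 (e.symm q).2 = ∑ j, ∑ i, F j i := fun F => by
    rw [← Fintype.sum_prod_type' F]
    exact Fintype.sum_equiv e.symm _ _ fun _ => rfl
  have key := hW n _ C k (hx.comp e.symm.injective) fun q => hxW _ _
  -- With m of 2m+1 modes occupied, m+1 are empty; this equals the number occupied after one
  -- creation, so row and column square sums have the same factor.
  have hd : (((2 * m + 1 : ℕ) : ℂ) - m) = ((m + 1 : ℝ) : ℂ) := by push_cast; ring
  have hL : l1TorusNorm (matrixTrigPoly C k) = (m + 1) * τ / √(2 * m + 1) *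
      ∫ t in (0 : ℝ)..1, ‖∑ i : Fin s, (c i : ℂ) * circleChar 1 (g * t) ^ (i : ℕ)‖ := by
    rw [l1TorusNorm, ← intervalIntegral.integral_const_mul]
    congr 1
    ext t
    -- The coefficients c i do not depend on the progression j, so the scalar polynomial splits off.
    have hf : matrixTrigPoly C k t = (∑ i : Fin s, (c i : ℂ) * circleChar 1 (g * t) ^ (i : ℕ)) •
        ∑ j, circleChar (x j) t • (a j * P m) := by
      calc matrixTrigPoly C k t = ∑ q, circleChar (k q) t • C q := rfl
        _ = ∑ j, ∑ i : Fin s, circleChar (x j + (i : ℕ) * g) t • ((c i : ℂ) • (a j * P m)) :=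
          hsum fun j i => circleChar (x j + (i : ℕ) * g) t • ((c i : ℂ) • (a j * P m))
        _ = _ := by
          rw [Finset.smul_sum]
          refine Finset.sum_congr rfl fun j _ => ?_
          rw [Finset.sum_smul]
          refine Finset.sum_congr rfl fun i _ => ?_
          rw [circleChar_add, circleChar_natCast_mul, smul_smul, smul_smul]
          congr 1; ring
    have hsq := h.sq_conjTranspose_mul_self (fun j => circleChar (x j) t) m
    have hc2 : (∑ j, ‖circleChar (x j) t‖ ^ 2 : ℝ) = √(2 * m + 1 : ℝ) ^ 2 := by
      rw [Real.sq_sqrt (by positivity)]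
      simp [norm_circleChar]
    rw [hc2] at hsq
    rw [hf, traceNorm_smul_of_sq_eq (by positivity) hsq,
      h.trace_conjTranspose_sum_mul_self _ fun j => norm_circleChar _ _, hd]
    have : (((m + 1 : ℝ) : ℂ) * ((2 * m + 1).choose m : ℂ)).re = (m + 1) * τ := by
      rw [Complex.re_ofReal_mul, Complex.natCast_re]
    rw [this, mul_comm]
  have hR : √(∑ i, c i ^ 2) * √(m + 1) * τ ≤ rcNorm C := by
    set N := ∑ i, c i ^ 2 with hN
    rcases (show 0 ≤ N from Finset.sum_nonneg fun i _ => sq_nonneg _).eq_or_lt with h0 | hNpos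
    · have := re_sum_trace_le_rcNorm C 0 (by simp) (by simp)
      rw [← h0]
      simpa using this
    -- This scaling turns the column and row square sums of r C into exactly P m and P (m + 1), both
    -- at most 1.
    set r : ℝ := 1 / (√N * √(m + 1)) with hr
    have hr2 : r ^ 2 * N * (m + 1) = 1 := by
      rw [hr, div_pow, mul_pow, Real.sq_sqrt hNpos.le, Real.sq_sqrt (by positivity)]
      field_simp
    have hr2' : ((r : ℂ) ^ 2 * N * ((m + 1 : ℝ) : ℂ)) = 1 := by exact_mod_cast hr2
    have hNc : (N : ℂ) = ∑ i, (c i : ℂ) ^ 2 := by rw [hN]; push_cast; rfl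
    have e1 : ∑ q, (C q)ᴴ * C q = ((N : ℂ) * ((m + 1 : ℝ) : ℂ)) • P m := by
      calc ∑ q, (C q)ᴴ * C q = ∑ j, ∑ i, (c i : ℂ) ^ 2 • ((a j * P m)ᴴ * (a j * P m)) := by
            rw [← hsum]
            refine Finset.sum_congr rfl fun q _ => ?_
            simp only [C, Matrix.conjTranspose_smul, smul_mul_smul_comm, Complex.star_def,
              Complex.conj_ofReal, sq]
        _ = _ := by
            simp only [← Finset.sum_smul]
            rw [← hNc, ← Finset.smul_sum, h.sum_conjTranspose_mul, smul_smul, hd]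
    have e2 : ∑ q, C q * (C q)ᴴ = ((N : ℂ) * ((m + 1 : ℝ) : ℂ)) • P (m + 1) := by
      calc ∑ q, C q * (C q)ᴴ = ∑ j, ∑ i, (c i : ℂ) ^ 2 • ((a j * P m) * (a j * P m)ᴴ) := by
            rw [← hsum]
            refine Finset.sum_congr rfl fun q _ => ?_
            simp only [C, Matrix.conjTranspose_smul, smul_mul_smul_comm, Complex.star_def,
              Complex.conj_ofReal, sq]
        _ = _ := by
            simp only [← Finset.sum_smul]
            rw [← hNc, ← Finset.smul_sum, h.sum_mul_conjTranspose, smul_smul]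
            push_cast; rfl
    have hle := re_sum_trace_le_rcNorm C (fun q => (r : ℂ) • C q) (by
      simp only [Matrix.conjTranspose_smul, smul_mul_smul_comm, Complex.star_def,
        Complex.conj_ofReal, ← Finset.smul_sum, e1, smul_smul]
      rw [← sq, ← mul_assoc, hr2', one_smul]
      exact h.projection_le_one m) (by
      simp only [Matrix.conjTranspose_smul, smul_mul_smul_comm, Complex.star_def,
        Complex.conj_ofReal, ← Finset.smul_sum, e2, smul_smul]
      rw [← sq, ← mul_assoc, hr2', one_smul]
      exact h.projection_le_one (m + 1))
    refine le_of_eq_of_le ?_ hle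
    simp only [Matrix.conjTranspose_smul, smul_mul_assoc, Matrix.trace_smul, ← Finset.smul_sum]
    rw [← Matrix.trace_sum, e1, Matrix.trace_smul, h.trace_eq, Complex.star_def,
      Complex.conj_ofReal]
    have : (r : ℂ) • ((N : ℂ) * ((m + 1 : ℝ) : ℂ)) • ((2 * m + 1).choose m : ℂ)
        = ((r * (N * (m + 1)) * τ : ℝ) : ℂ) := by
      simp only [smul_eq_mul, τ]; push_cast; ring
    rw [this, Complex.ofReal_re]
    congr 1
    have hA : √N * √N = N := Real.mul_self_sqrt hNpos.le
    have hB : √(m + 1 : ℝ) * √(m + 1 : ℝ) = m + 1 := Real.mul_self_sqrt (by positivity)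
    have hA0 : √N ≠ 0 := (Real.sqrt_pos.2 hNpos).ne'
    have hB0 : √(m + 1 : ℝ) ≠ 0 := (Real.sqrt_pos.2 (by positivity)).ne'
    rw [hr]
    rw [one_div_mul_eq_div, eq_div_iff (mul_ne_zero hA0 hB0), mul_mul_mul_comm, hA, hB]
  rw [hL] at key
  have hfin := (mul_le_mul_of_nonneg_left hR (by positivity : 0 ≤ 1 / √2)).trans key
  set I := ∫ t in (0 : ℝ)..1, ‖∑ i : Fin s, (c i : ℂ) * circleChar 1 (g * t) ^ (i : ℕ)‖
  have hB : √(m + 1 : ℝ) * √(m + 1 : ℝ) = m + 1 := Real.mul_self_sqrt (by positivity)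
  have hB0 : 0 < √(m + 1 : ℝ) := Real.sqrt_pos.2 (by positivity)
  have hD0 : 0 < √(2 * m + 1 : ℝ) := Real.sqrt_pos.2 (by positivity)
  have h20 : 0 < √(2 : ℝ) := by positivity
  have e3 : 1 / √2 * (√(∑ i, c i ^ 2) * √(m + 1) * τ)
      = (√(∑ i, c i ^ 2) * √(2 * m + 1)) * (√(m + 1) * τ / (√2 * √(2 * m + 1))) := by
    field_simp
  have e4 : (m + 1) * τ / √(2 * m + 1) * I
      = (√2 * √(m + 1) * I) * (√(m + 1) * τ / (√2 * √(2 * m + 1))) := by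
    calc (m + 1) * τ / √(2 * m + 1) * I
        = √(m + 1) * √(m + 1) * τ / √(2 * m + 1) * I := by rw [hB]
      _ = _ := by field_simp
  rw [e3, e4] at hfin
  exact le_of_mul_le_mul_right hfin (by positivity)

/-! ### L¹ norms of the scalar test polynomials -/

theorem circleChar_one_periodic : Function.Periodic (circleChar 1) 1 := fun t => by
  have : (2 * Real.pi * Complex.I * ((1 : ℤ) : ℂ) * ((t + 1 : ℝ) : ℂ))
      = 2 * Real.pi * Complex.I * ((1 : ℤ) : ℂ) * (t : ℂ) + 2 * Real.pi * Complex.I := by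
    push_cast; ring
  rw [circleChar, circleChar, this, Complex.exp_add, Complex.exp_two_pi_mul_I, mul_one]

theorem continuous_circleChar (k : ℤ) : Continuous (circleChar k) := by
  unfold circleChar; fun_prop

theorem circleChar_one_re (t : ℝ) : (circleChar 1 t).re = Real.cos (2 * Real.pi * t) := by
  rw [circleChar_eq, Complex.exp_ofReal_mul_I_re]; simp

theorem circleChar_one_im (t : ℝ) : (circleChar 1 t).im = Real.sin (2 * Real.pi * t) := by
  rw [circleChar_eq, Complex.exp_ofReal_mul_I_im]; simp

/-- Integrals over the circle are invariant under the covering map `t ↦ g t`. -/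
theorem integral_comp_intCast_mul {f : ℝ → ℝ} (hf : Continuous f) (hp : Function.Periodic f 1)
    {g : ℤ} (hg : g ≠ 0) : ∫ t in (0 : ℝ)..1, f (g * t) = ∫ t in (0 : ℝ)..1, f t := by
  have hg' : (g : ℝ) ≠ 0 := by exact_mod_cast hg
  rw [intervalIntegral.integral_comp_mul_left _ hg']
  have := hp.intervalIntegral_add_zsmul_eq g 0 fun _ _ => hf.intervalIntegrable _ _
  simp only [zsmul_eq_mul, mul_one, zero_add] at this
  rw [mul_zero, mul_one, this, smul_eq_mul, inv_mul_cancel_left₀ hg']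

theorem integral_cos_two_pi_mul : ∫ t in (0 : ℝ)..1, Real.cos (2 * Real.pi * t) = 0 := by
  rw [intervalIntegral.integral_comp_mul_left _ (by positivity)]
  simp

theorem norm_one_add_circleChar_sq (t : ℝ) :
    ‖1 + circleChar 1 t‖ ^ 2 = 2 + 2 * Real.cos (2 * Real.pi * t) := by
  rw [← Complex.normSq_eq_norm_sq, Complex.normSq_apply]
  simp only [Complex.add_re, Complex.add_im, Complex.one_re, Complex.one_im, circleChar_one_re,
    circleChar_one_im]
  linear_combination Real.sin_sq_add_cos_sq (2 * Real.pi * t)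

theorem norm_one_add_circleChar_add_sq_sq (t : ℝ) :
    ‖1 + circleChar 1 t + circleChar 1 t ^ 2‖ ^ 2
      = 3 + 4 * Real.cos (2 * Real.pi * t) + 2 * Real.cos (2 * (2 * Real.pi * t)) := by
  rw [← Complex.normSq_eq_norm_sq, Complex.normSq_apply, Real.cos_two_mul]
  simp only [Complex.add_re, Complex.add_im, Complex.one_re, Complex.one_im, circleChar_one_re,
    circleChar_one_im, sq, Complex.mul_re, Complex.mul_im]
  have h := Real.sin_sq (2 * Real.pi * t)
  set s := Real.sin (2 * Real.pi * t)
  set c := Real.cos (2 * Real.pi * t)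
  have : (1 + c + (c * c - s * s)) = c * (2 * c + 1) := by linear_combination -h
  rw [this]
  linear_combination (1 + 2 * c) ^ 2 * h

/-- This is also the L¹ norm of (1+z)² = 1+2z+z²: for a perfect square the L¹ norm is the squared L²
norm of the root. -/
theorem integral_norm_one_add_circleChar_sq :
    ∫ t in (0 : ℝ)..1, ‖1 + circleChar 1 t‖ ^ 2 = 2 := by
  simp only [norm_one_add_circleChar_sq]
  rw [intervalIntegral.integral_add, intervalIntegral.integral_const_mul, integral_cos_two_pi_mul]
  · simp
  all_goals exact Continuous.intervalIntegrable (by fun_prop) _ _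

/-- This gives the L¹ norm of (1+z+z²)², with coefficients 1, 2, 3, 2, 1. -/
theorem integral_norm_one_add_circleChar_add_sq_sq :
    ∫ t in (0 : ℝ)..1, ‖1 + circleChar 1 t + circleChar 1 t ^ 2‖ ^ 2 = 3 := by
  have h4 : ∫ t in (0 : ℝ)..1, Real.cos (2 * (2 * Real.pi * t)) = 0 := by
    have hs : Real.sin (2 * (2 * Real.pi)) = 0 := by
      rw [Real.sin_two_mul, Real.sin_two_pi]; ring
    simp_rw [← mul_assoc 2 (2 * Real.pi)]
    rw [intervalIntegral.integral_comp_mul_left _ (by positivity)]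
    simp [hs]
  simp only [norm_one_add_circleChar_add_sq_sq]
  rw [intervalIntegral.integral_add, intervalIntegral.integral_add,
    intervalIntegral.integral_const_mul, intervalIntegral.integral_const_mul,
    integral_cos_two_pi_mul, h4]
  · simp
  all_goals exact Continuous.intervalIntegrable (by fun_prop) _ _

/-- On the period [-1/2, 1/2] the integrand is 2 cos(πt), with no absolute value needed. -/
theorem integral_norm_one_add_circleChar :
    ∫ t in (0 : ℝ)..1, ‖1 + circleChar 1 t‖ = 4 / Real.pi := by
  have hp : Function.Periodic (fun t => ‖1 + circleChar 1 t‖) 1 := fun t => by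
    simp only [circleChar_one_periodic t]
  have h1 := hp.intervalIntegral_add_eq 0 (-1 / 2)
  rw [zero_add] at h1
  rw [h1]
  have h2 : ∫ t in (-1 / 2 : ℝ)..(-1 / 2 + 1), ‖1 + circleChar 1 t‖
      = ∫ t in (-1 / 2 : ℝ)..(-1 / 2 + 1), 2 * Real.cos (Real.pi * t) := by
    refine intervalIntegral.integral_congr fun t ht => ?_
    rw [Set.uIcc_of_le (by norm_num)] at ht
    have hc : 0 ≤ Real.cos (Real.pi * t) := Real.cos_nonneg_of_mem_Icc
      ⟨by nlinarith [Real.pi_pos, ht.1], by nlinarith [Real.pi_pos, ht.2]⟩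
    refine (pow_left_inj₀ (norm_nonneg _) (by positivity) two_ne_zero).1 ?_
    rw [norm_one_add_circleChar_sq, mul_assoc 2 Real.pi, Real.cos_two_mul]
    ring
  rw [h2, intervalIntegral.integral_const_mul,
    intervalIntegral.integral_comp_mul_left _ Real.pi_ne_zero, integral_cos]
  have e1 : Real.pi * (-1 / 2 + 1) = Real.pi / 2 := by ring
  have e2 : Real.pi * (-1 / 2) = -(Real.pi / 2) := by ring
  rw [e1, e2, Real.sin_neg, Real.sin_pi_div_two, smul_eq_mul]
  field_simp
  norm_num

/-! ### Disjoint progressions inside W -/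

/-- Progressions of step `g` and length `s` starting in `S` are disjoint if no two starting points
differ by one of `g, …, (s-1)g`. -/
theorem injective_progressions {ι : Type*} {S : Set ℤ} {g : ℤ} {s : ℕ}
    (hS : ∀ x ∈ S, ∀ k : ℕ, 0 < k → k < s → x + k * g ∉ S) {e : ι → ℤ}
    (he : Function.Injective e) (heS : ∀ j, e j ∈ S) :
    Function.Injective fun p : ι × Fin s => e p.1 + (p.2 : ℕ) * g := by
  have aux : ∀ (j l : ι) (i r : Fin s), (i : ℕ) < r →
      e j + (i : ℕ) * g ≠ e l + (r : ℕ) * g := fun j l i r hir hpq => by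
    refine hS (e l) (heS l) ((r : ℕ) - i) (by omega) (by omega) ?_
    have : e l + ((r : ℕ) - i : ℕ) * g = e j := by
      rw [Nat.cast_sub hir.le]; linear_combination -hpq
    rw [this]
    exact heS j
  rintro ⟨j, i⟩ ⟨l, r⟩ hpq
  rcases lt_trichotomy (i : ℕ) r with h | h | h
  · exact (aux j l i r h hpq).elim
  · obtain rfl := Fin.ext h
    exact Prod.ext (he (add_right_cancel hpq)) rfl
  · exact (aux l j r i h hpq.symm).elim

/-- The squared form of `khintchine_progressions`. -/
theorem khintchine_progressions_sq {W : Set ℤ}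
    (hW : ∀ (n d : ℕ) (C : Fin d → Matrix (Fin n) (Fin n) ℂ) (k : Fin d → ℤ),
      Function.Injective k → (∀ i, k i ∈ W) →
        1 / √2 * rcNorm C ≤ l1TorusNorm (matrixTrigPoly C k))
    (m s : ℕ) (c : Fin s → ℝ) {g : ℤ} (hg : g ≠ 0) {S : Finset ℤ} (hc : S.card = 2 * m + 1)
    (hS : ∀ x ∈ S, ∀ k : ℕ, 0 < k → k < s → x + k * g ∉ S)
    (hSW : ∀ x ∈ S, ∀ i : Fin s, x + (i : ℕ) * g ∈ W) :
    (∑ i, c i ^ 2) * (2 * m + 1) ≤ 2 * (m + 1) *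
      (∫ t in (0 : ℝ)..1, ‖∑ i : Fin s, (c i : ℂ) * circleChar 1 t ^ (i : ℕ)‖) ^ 2 := by
  let e := S.equivFinOfCardEq hc
  have key := khintchine_progressions hW m s c g (fun j => (e.symm j : ℤ))
    (injective_progressions (S := S) hS (Subtype.val_injective.comp e.symm.injective)
      fun j => (e.symm j).2) fun j => hSW _ (e.symm j).2
  have hcont := continuous_circleChar 1
  -- The step g only winds the circle around itself and drops out of the integral.
  rw [integral_comp_intCast_mul
    (f := fun t => ‖∑ i : Fin s, (c i : ℂ) * circleChar 1 t ^ (i : ℕ)‖) (by fun_prop)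
    (fun t => by simp only [circleChar_one_periodic t]) hg] at key
  have h2 := pow_le_pow_left₀ (by positivity) key 2
  rwa [mul_pow, mul_pow, mul_pow, Real.sq_sqrt (Finset.sum_nonneg fun i _ => sq_nonneg _),
    Real.sq_sqrt (by positivity), Real.sq_sqrt (by positivity), Real.sq_sqrt (by positivity)] at h2

/-- Seven integers `x`, thought of as the pairs `(x, x + g)`, contain a progression of
length five, three disjoint progressions of length three, or five disjoint pairs. -/
theorem exists_progressions {g : ℤ} {F : Finset ℤ} (hF : F.card = 7)
    (h5 : ∀ x, ¬ (x ∈ F ∧ x + g ∈ F ∧ x + 2 * g ∈ F ∧ x + 3 * g ∈ F)) :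
    (∃ S ⊆ F, S.card = 3 ∧ (∀ x ∈ S, x + g ∈ F) ∧ ∀ x ∈ S, x + g ∉ S ∧ x + 2 * g ∉ S) ∨
      ∃ S ⊆ F, S.card = 5 ∧ ∀ x ∈ S, x + g ∉ S := by
  -- By `h5` the maximal g-runs in F have length at most 3. `S₂` holds the first points of runs of
  -- length at least 2, `N` the second points, `M` the first and third points; x ↦ x - g sends `N`
  -- into `S₂`.
  set S₂ := F.filter fun x => x - g ∉ F ∧ x + g ∈ F with hS₂
  set M := F.filter fun x => x - g ∈ F → x - 2 * g ∈ F with hM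
  set N := F.filter fun x => ¬ (x - g ∈ F → x - 2 * g ∈ F) with hN
  have hMN : M.card + N.card = 7 := by
    rw [← hF]; exact Finset.card_filter_add_card_filter_not _
  have hNS : N.card ≤ S₂.card := by
    refine Finset.card_le_card_of_injOn (fun x => x - g) (fun x hx => ?_)
      fun x _ y _ hxy => sub_left_injective hxy
    simp only [hN, Finset.coe_filter, Set.mem_ofPred_eq, Classical.not_imp] at hx
    simp only [hS₂, Finset.coe_filter, Set.mem_ofPred_eq, sub_add_cancel, sub_sub, ← two_mul]
    exact ⟨hx.2.1, hx.2.2, hx.1⟩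
  by_cases h3 : 3 ≤ S₂.card
  · obtain ⟨S, hS, hc⟩ := Finset.exists_subset_card_eq h3
    refine .inl ⟨S, hS.trans (Finset.filter_subset _ _), hc,
      fun x hx => (Finset.mem_filter.1 (hS hx)).2.2, fun x hx => ⟨fun hy => ?_, fun hy => ?_⟩⟩
    · have := (Finset.mem_filter.1 (hS hy)).2.1
      rw [add_sub_cancel_right] at this
      exact this (Finset.mem_filter.1 (hS hx)).1
    · have := (Finset.mem_filter.1 (hS hy)).2.1
      rw [show x + 2 * g - g = x + g by ring] at this
      exact this (Finset.mem_filter.1 (hS hx)).2.2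
  · obtain ⟨S, hS, hc⟩ := Finset.exists_subset_card_eq (show 5 ≤ M.card by omega)
    refine .inr ⟨S, hS.trans (Finset.filter_subset _ _), hc, fun x hx hy => ?_⟩
    obtain ⟨hxF, hx'⟩ := Finset.mem_filter.1 (hS hx)
    obtain ⟨hyF, hy'⟩ := Finset.mem_filter.1 (hS hy)
    rw [add_sub_cancel_right, show x + g - 2 * g = x - g by ring] at hy'
    -- Two neighbours x, x + g in `M` would force x - g and x - 2g into F, a run of length 4.
    have h1 := hy' hxF
    refine h5 (x - 2 * g) ⟨hx' h1, ?_, ?_, ?_⟩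
    · rwa [show x - 2 * g + g = x - g by ring]
    · rwa [sub_add_cancel]
    · rwa [show x - 2 * g + 3 * g = x + g by ring]

end Khintchine

/-! ### The three contradictions -/

theorem theorem3p5 (W : Set ℤ)
    (hW : ∀ (n d : ℕ) (C : Fin d → Matrix (Fin n) (Fin n) ℂ) (k : Fin d → ℤ),
      Function.Injective k → (∀ i, k i ∈ W) →
        1 / √2 * rcNorm C ≤ l1TorusNorm (matrixTrigPoly C k)) :
    zTwo W ≤ 6 := by
  refine iSup₂_le fun g hg => ?_
  by_contra hlt
  have h7 : (7 : ℕ∞) ≤ {p : ℤ × ℤ | p.1 ∈ W ∧ p.2 ∈ W ∧ -p.1 + p.2 = g}.encard := by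
    have := Order.add_one_le_of_lt (not_le.1 hlt)
    exact le_of_eq_of_le (by norm_num) this
  obtain ⟨T, hT, hTc⟩ := Set.exists_subset_encard_eq h7
  -- With g fixed, a pair is determined by its first entry, so seven pairs become seven integers.
  have hinj : Set.InjOn Prod.fst T := fun p hp q hq hpq => by
    have h1 := (hT hp).2.2
    have h2 := (hT hq).2.2
    exact Prod.ext hpq (by rw [hpq] at h1; linarith)
  have hFc := hinj.encard_image
  rw [hTc] at hFc
  have hfin : (Prod.fst '' T).Finite := Set.finite_of_encard_eq_coe (k := 7) hFc
  lift Prod.fst '' T to Finset ℤ using hfin with F hFT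
  have hF : F.card = 7 := by
    rw [Set.encard_coe_eq_coe_finsetCard] at hFc; exact_mod_cast hFc
  have hFW : ∀ x ∈ F, x ∈ W ∧ x + g ∈ W := fun x hx => by
    have : x ∈ Prod.fst '' T := by rw [← hFT]; exact hx
    obtain ⟨p, hp, rfl⟩ := this
    obtain ⟨h1, h2, h3⟩ := hT hp
    exact ⟨h1, by rwa [← h3, add_neg_cancel_left]⟩
  by_cases h5 : ∃ x, x ∈ F ∧ x + g ∈ F ∧ x + 2 * g ∈ F ∧ x + 3 * g ∈ F
  · obtain ⟨x, h0, h1, h2, h3⟩ := h5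
    have key := khintchine_progressions_sq hW 0 5 ![1, 2, 3, 2, 1] hg (S := {x}) (by simp)
      (fun y hy k hk _ hy' => by
        rw [Finset.mem_singleton] at hy hy'
        subst hy
        have : (k : ℤ) * g ≠ 0 := mul_ne_zero (by exact_mod_cast hk.ne') hg
        exact this (by linarith))
      (fun y hy i => by
        obtain rfl := Finset.mem_singleton.1 hy
        have h4 := (hFW _ h3).2
        -- Four consecutive points of F give five in W, since x + g is in W for each x in F.
        rw [show y + 3 * g + g = y + 4 * g by ring] at h4
        fin_cases i
        · simpa using (hFW _ h0).1
        · simpa using (hFW _ h1).1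
        · simpa using (hFW _ h2).1
        · simpa using (hFW _ h3).1
        · simpa using h4)
    have hI : ∫ t in (0 : ℝ)..1, ‖∑ i : Fin 5, ((![1, 2, 3, 2, 1] i : ℝ) : ℂ) *
        circleChar 1 t ^ (i : ℕ)‖ = 3 := by
      refine Eq.trans ?_ integral_norm_one_add_circleChar_add_sq_sq
      congr 1; ext t
      rw [← norm_pow]
      congr 1
      simp [Fin.sum_univ_five]
      ring
    have hs : ∑ i, (![1, 2, 3, 2, 1] : Fin 5 → ℝ) i ^ 2 = 19 := by
      simp [Fin.sum_univ_five]; norm_num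
    rw [hI, hs] at key
    norm_num at key
  · rcases exists_progressions hF (not_exists.1 h5) with ⟨S, hSF, hc, hS, hS'⟩ | ⟨S, hSF, hc, hS⟩
    · have key := khintchine_progressions_sq hW 1 3 ![1, 2, 1] hg hc
        (fun x hx k hk hk3 => by
          obtain rfl | rfl : k = 1 ∨ k = 2 := by omega
          · simpa using (hS' x hx).1
          · simpa using (hS' x hx).2)
        (fun x hx i => by
          have h1 := hFW _ (hSF hx)
          have h2 := hFW _ (hS _ hx)
          rw [add_assoc, ← two_mul] at h2
          fin_cases i
          · simpa using h1.1
          · simpa using h1.2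
          · simpa using h2.2)
      have hI : ∫ t in (0 : ℝ)..1, ‖∑ i : Fin 3, ((![1, 2, 1] i : ℝ) : ℂ) *
          circleChar 1 t ^ (i : ℕ)‖ = 2 := by
        refine Eq.trans ?_ integral_norm_one_add_circleChar_sq
        congr 1; ext t
        rw [← norm_pow]
        congr 1
        simp [Fin.sum_univ_three]
        ring
      have hs : ∑ i, (![1, 2, 1] : Fin 3 → ℝ) i ^ 2 = 6 := by
        simp [Fin.sum_univ_three]; norm_num
      rw [hI, hs] at key
      norm_num at key
    · have key := khintchine_progressions_sq hW 2 2 ![1, 1] hg hc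
        (fun x hx k hk hk2 => by
          obtain rfl : k = 1 := by omega
          simpa using hS x hx)
        (fun x hx i => by
          have h1 := hFW _ (hSF hx)
          fin_cases i
          · simpa using h1.1
          · simpa using h1.2)
      have hI : ∫ t in (0 : ℝ)..1, ‖∑ i : Fin 2, ((![1, 1] i : ℝ) : ℂ) *
          circleChar 1 t ^ (i : ℕ)‖ = 4 / Real.pi := by
        refine Eq.trans ?_ integral_norm_one_add_circleChar
        congr 1; ext t
        simp
      rw [hI, div_pow, mul_div_assoc', le_div_iff₀ (by positivity)] at key
      norm_num at key
      -- The inequality 10 π² ≤ 96 is refuted by π > 3.14.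
      nlinarith [Real.pi_gt_d2]
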